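/- For $n\ge 1$ let $Mb_n$ be the set of crossingless connections of $2n$ labelled marked points on the boundary circle of a Möbius band, i.e. the isotopy classes (fixing the marked points) of families of $n$ pairwise disjoint properly embedded arcs in the Möbius band whose endpoints are exactly the $2n$ marked points. Given $m_1,m_2\in Mb_n$, glue the Möbius band containing $m_1$ to a second Möbius band, containing the inversion of $m_2$, along their boundary circles, respecting the labels of the marked points. The result is a Klein bottle with a finite family of pairwise disjoint simple closed curves. Each of these curves is of exactly one of five types: contractible; isotopic to the core of the first Möbius band (it runs through the crosscap of $m_1$ only); isotopic to the core of the second Möbius band; isotopic to the common boundary circle of the two Möbius bands (it separates the two crosscaps); or two-sided and nonseparating (it runs through both crosscaps). Let $\langle m_1,m_2\rangle=d^{a}x^{b}y^{c}z^{e}w^{f}$, where $a,b,c,e,f$ are the numbers of curves of these five types, in this order. The Gram determinant of type $Mb$ is $$D^{(Mb)}_n=D^{(Mb)}_n(d,w,x,y,z)=\det\big(\langle m_i,m_j\rangle\big)_{m_i,m_j\in Mb_n}\in\mathbb{Z}[d,w,x,y,z],$$ and $D^{(Mb)}_0=1$ (there is only the empty connection). **Theorem.** Let $n\ge 1$. If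 $d^2-1$ is invertible, then $\big(D^{(Mb)}_{n-1}\big)^2$ divides $D^{(Mb)}_n$. That is, for every commutative ring $R$ and all $d,w,x,y,z\in R$ such that $d^2-1$ is a unit of $R$, the element $\big(D^{(Mb)}_{n-1}(d,w,x,y,z)\big)^2$ divides $D^{(Mb)}_n(d,w,x,y,z)$ in $R$ (in particular in $R=\mathbb{Z}[d,w,x,y,z][(d^2-1)^{-1}]$). -/

import Mathlib

namespace MobiusGram

/-!
### Crossingless connections on the Möbius band

The universal cover of the Möbius band is the strip `ℝ × [0, 1]`.  The Möbius band is the quotient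
of the strip by the glide reflection `(t, s) ↦ (t + n, 1 - s)`; its boundary circle has length
`2n` and carries the `2n` marked points that are the images of the integer points of the two
boundary lines.  A point `(i, false)` is the integer point `i` of the first boundary line of the
strip, `(i, true)` the integer point `i` of the second one.
-/

/-- The generating deck transformation of the strip over the Möbius band with `2n` marked points,
on the lifts of the marked points. -/
def shift (n : ℕ) (p : ℤ × Bool) : ℤ × Bool := (p.1 + n, !p.2)

/-- The order in which the lifts of the marked points are met along the boundary of the strip:
first the line `false` from left to right, then the line `true` from right to left. -/
def Precedes : ℤ × Bool → ℤ × Bool → Prop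
  | (i, false), (j, false) => i < j
  | (_, false), (_, true) => True
  | (_, true), (_, false) => False
  | (i, true), (j, true) => j < i

/-- A crossingless connection of the `2n` marked points on the boundary of the Möbius band, up to
isotopy fixing the marked points (`n ≥ 1`): the family of `n` disjoint arcs is recorded by the
endpoints of all its lifts to the strip.  These lifts match the lifted marked points in pairs,
the matching is invariant under deck transformations, and two arcs in the strip can be made
disjoint exactly when their endpoints are not interleaved on the boundary. -/
@[ext]
structure Diagram (n : ℕ) where
  /-- The other endpoint of the lifted arc that starts at a given lifted marked point. -/
  mate : ℤ × Bool → ℤ × Bool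
  mate_mate : ∀ p, mate (mate p) = p
  mate_ne : ∀ p, mate p ≠ p
  mate_shift : ∀ p, mate (shift n p) = shift n (mate p)
  noncrossing : ∀ p q, ¬ (Precedes p q ∧ Precedes q (mate p) ∧ Precedes (mate p) (mate q))

/-!
### There are finitely many crossingless connections
-/

theorem Diagram.mate_add {n : ℕ} (f : Diagram n) (i : ℤ) (b : Bool) (k : ℤ) :
    f.mate (i + 2 * n * k, b) = ((f.mate (i, b)).1 + 2 * n * k, (f.mate (i, b)).2) := by
  have step : ∀ (j : ℤ), f.mate (j + 2 * n, b) =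
      ((f.mate (j, b)).1 + 2 * n, (f.mate (j, b)).2) := by
    intro j
    have h1 : f.mate (shift n (shift n (j, b))) = shift n (shift n (f.mate (j, b))) := by
      rw [f.mate_shift, f.mate_shift]
    have h2 : shift n (shift n (j, b)) = (j + 2 * n, b) := by
      simp [shift]; ring
    rw [h2] at h1
    rw [h1]
    simp [shift]; ring
  induction k using Int.induction_on with
  | zero => simp
  | succ k ih =>
    have h := step (i + 2 * n * k)
    rw [ih] at h
    rw [show i + 2 * (n : ℤ) * ((k : ℤ) + 1) = i + 2 * n * k + 2 * n by ring, h]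
    ext <;> simp; ring
  | pred k ih =>
    have h := step (i + 2 * n * (-(k : ℤ) - 1))
    rw [show i + 2 * (n : ℤ) * (-(k : ℤ) - 1) + 2 * n = i + 2 * n * (-k) by ring, ih] at h
    simp only [Prod.mk.injEq] at h
    ext
    · simp only; linarith [h.1]
    · simp only; rw [h.2]

theorem Diagram.mate_bound {n : ℕ} [NeZero n] (f : Diagram n) (i : ℤ) :
    |(f.mate (i, false)).1 - i| ≤ 2 * n := by
  have hn := NeZero.pos n
  obtain ⟨⟨j, b⟩, h⟩ : ∃ q, f.mate (i, false) = q := ⟨_, rfl⟩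
  have h' : f.mate (j, b) = (i, false) := by rw [← h, f.mate_mate]
  rw [h, abs_le]
  cases b
  · constructor
    · by_contra hc
      have hs := f.mate_add j false 1
      rw [h'] at hs
      refine f.noncrossing (j, false) (j + 2 * n * 1, false) ?_
      rw [hs, h']
      simp only [Precedes] at hc ⊢
      refine ⟨?_, ?_, ?_⟩ <;> omega
    · by_contra hc
      have hs := f.mate_add i false 1
      rw [h] at hs
      refine f.noncrossing (i, false) (i + 2 * n * 1, false) ?_
      rw [hs, h]
      simp only [Precedes] at hc ⊢
      refine ⟨?_, ?_, ?_⟩ <;> omega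
  · have hs : f.mate (j + n, false) = (i + n, true) := by
      have := f.mate_shift (j, true)
      rw [h'] at this
      simpa [shift] using this
    constructor
    · by_contra hc
      refine f.noncrossing (j + n, false) (i, false) ?_
      rw [hs, h]
      simp only [Precedes] at hc ⊢
      refine ⟨?_, trivial, ?_⟩ <;> omega
    · by_contra hc
      refine f.noncrossing (i, false) (j + n, false) ?_
      rw [hs, h]
      simp only [Precedes] at hc ⊢
      refine ⟨?_, trivial, ?_⟩ <;> omega

instance (n : ℕ) [NeZero n] : Finite (Diagram n) := by
  have hn : (0 : ℤ) < 2 * n := by have := NeZero.pos n; omega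
  let φ : Diagram n → (Set.Ico (0 : ℤ) (2 * n) →
      (Set.Icc (-(2 * n : ℤ)) (2 * n + 2 * n) ×ˢ (Set.univ : Set Bool) : Set (ℤ × Bool))) :=
    fun f i => ⟨f.mate (i.1, false), by
      have h := abs_le.1 (f.mate_bound i.1)
      have h2 := i.2
      simp only [Set.mem_Ico] at h2
      simp only [Set.mem_prod, Set.mem_Icc, Set.mem_univ, and_true]
      constructor <;> omega⟩
  have : Finite (Set.Icc (-(2 * n : ℤ)) (2 * n + 2 * n) ×ˢ (Set.univ : Set Bool) :
      Set (ℤ × Bool)) := ((Set.finite_Icc _ _).prod Set.finite_univ).to_subtype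
  refine Finite.of_injective φ ?_
  intro f g hfg
  have h0 : ∀ i : ℤ, f.mate (i, false) = g.mate (i, false) := by
    intro i
    have hm : i % (2 * n) ∈ Set.Ico (0 : ℤ) (2 * n) :=
      ⟨Int.emod_nonneg _ hn.ne', Int.emod_lt_of_pos _ hn⟩
    have h1 : f.mate (i % (2 * n), false) = g.mate (i % (2 * n), false) :=
      congrArg Subtype.val (congrFun hfg ⟨_, hm⟩)
    have h2 := f.mate_add (i % (2 * n)) false (i / (2 * n))
    have h3 := g.mate_add (i % (2 * n)) false (i / (2 * n))
    rw [Int.emod_add_mul_ediv] at h2 h3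
    rw [h2, h3, h1]
  ext1
  funext p
  obtain ⟨i, b⟩ := p
  cases b
  · exact h0 i
  · have e : ((i, true) : ℤ × Bool) = shift n (i - n, false) := by simp [shift]
    rw [e, f.mate_shift, g.mate_shift, h0]

noncomputable instance (n : ℕ) [NeZero n] : Fintype (Diagram n) := Fintype.ofFinite _

/-!
### Gluing two Möbius bands to a Klein bottle

Two Möbius bands, glued along their boundary circles, give a Klein bottle.  Its universal cover is
the plane, in which the lines of integer height are the lifts of the common boundary circle; the
lifted marked points are the points of `ℤ × ℤ`, written `(position, height)`.  The strips between
the heights `2m` and `2m + 1` cover the first Möbius band, the strips between the heights `2m - 1`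
and `2m` cover the (inverted) second one; the lines of even height are the lines `false` of both
adjacent strips, those of odd height the lines `true`.
-/

/-- The deck transformation given by the core of the first Möbius band. -/
def deck₁ (n : ℕ) (u : ℤ × ℤ) : ℤ × ℤ := (u.1 + n, 1 - u.2)

/-- The deck transformation given by the core of the second Möbius band. -/
def deck₂ (n : ℕ) (u : ℤ × ℤ) : ℤ × ℤ := (u.1 + n, -1 - u.2)

/-- Two lifted marked points are the endpoints of a lifted arc of `f`, drawn in the first Möbius
band, or of `g`, drawn in the second one. -/
inductive Joined {n : ℕ} (f g : Diagram n) : ℤ × ℤ → ℤ × ℤ → Prop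
  | first (m i j : ℤ) (b c : Bool) (h : f.mate (i, b) = (j, c)) :
      Joined f g (i, 2 * m + b.toNat) (j, 2 * m + c.toNat)
  | second (m i j : ℤ) (b c : Bool) (h : g.mate (i, b) = (j, c)) :
      Joined f g (i, 2 * m - b.toNat) (j, 2 * m - c.toNat)

/-- Two lifted marked points lie on the same component of the preimage, in the universal cover of
the Klein bottle, of the closed curves formed by `f` and `g`. -/
def SameLift {n : ℕ} (f g : Diagram n) : ℤ × ℤ → ℤ × ℤ → Prop :=
  Relation.EqvGen (Joined f g)

/-- Two lifted marked points lie over the same closed curve on the Klein bottle. -/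
def sameCurve {n : ℕ} (f g : Diagram n) : Setoid (ℤ × ℤ) :=
  Relation.EqvGen.setoid fun u v => Joined f g u v ∨ v = deck₁ n u ∨ v = deck₂ n u

/-- The closed curves on the Klein bottle obtained by gluing `f` and `g`. -/
def Curve {n : ℕ} (f g : Diagram n) : Type := Quotient (sameCurve f g)

instance {n : ℕ} [NeZero n] (f g : Diagram n) : Finite (Curve f g) := by
  have hn : (0 : ℤ) < 2 * n := by have := NeZero.pos n; omega
  let q : ℤ × ℤ → Curve f g := fun u => Quotient.mk (sameCurve f g) u
  have h₁ : ∀ u, q (deck₁ n u) = q u := fun u =>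
    (Quotient.sound (s := sameCurve f g) (Relation.EqvGen.rel _ _ (Or.inr (Or.inl rfl)))).symm
  have h₂ : ∀ u, q (deck₂ n u) = q u := fun u =>
    (Quotient.sound (s := sameCurve f g) (Relation.EqvGen.rel _ _ (Or.inr (Or.inr rfl)))).symm
  have hx : ∀ i h : ℤ, q (i + 2 * n, h) = q (i, h) := by
    intro i h
    have e : deck₁ n (deck₁ n (i, h)) = (i + 2 * n, h) := by simp [deck₁]; ring
    rw [← e, h₁, h₁]
  have hy : ∀ i h : ℤ, q (i, h + 2) = q (i, h) := by
    intro i h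
    have a := h₁ (i - n, -1 - h)
    have b := h₂ (i - n, -1 - h)
    have ea : deck₁ n (i - n, -1 - h) = (i, h + 2) := by simp [deck₁]; ring
    have eb : deck₂ n (i - n, -1 - h) = (i, h) := by simp [deck₂]
    rw [ea] at a
    rw [eb] at b
    rw [a, b]
  have hx' : ∀ k i h : ℤ, q (i + 2 * n * k, h) = q (i, h) := by
    intro k
    induction k using Int.induction_on with
    | zero => simp
    | succ k ih =>
      intro i h
      rw [← ih i h, ← hx (i + 2 * n * k)]; congr 2; ring
    | pred k ih =>
      intro i h
      rw [← ih i h, ← hx]; congr 2; ring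
  have hy' : ∀ k i h : ℤ, q (i, h + 2 * k) = q (i, h) := by
    intro k
    induction k using Int.induction_on with
    | zero => simp
    | succ k ih =>
      intro i h
      rw [← ih i h, ← hy i (h + 2 * k)]; congr 2; ring
    | pred k ih =>
      intro i h
      rw [← ih i h, ← hy]; congr 2; ring
  let ψ : (Set.Ico (0 : ℤ) (2 * n) ×ˢ Set.Ico (0 : ℤ) 2 : Set (ℤ × ℤ)) → Curve f g :=
    fun u => q u.1
  have : Finite (Set.Ico (0 : ℤ) (2 * n) ×ˢ Set.Ico (0 : ℤ) 2 : Set (ℤ × ℤ)) :=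
    ((Set.finite_Ico _ _).prod (Set.finite_Ico _ _)).to_subtype
  refine Finite.of_surjective ψ ?_
  intro c
  obtain ⟨⟨i, h⟩, rfl⟩ := Quotient.exists_rep c
  refine ⟨⟨(i % (2 * n), h % 2), ⟨⟨Int.emod_nonneg _ hn.ne', Int.emod_lt_of_pos _ hn⟩,
    ⟨Int.emod_nonneg _ (by norm_num), Int.emod_lt_of_pos _ (by norm_num)⟩⟩⟩, ?_⟩
  change q (i % (2 * n), h % 2) = q (i, h)
  rw [← hx' (i / (2 * n)), ← hy' (h / 2), Int.emod_add_mul_ediv, Int.emod_add_mul_ediv]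

noncomputable instance {n : ℕ} [NeZero n] (f g : Diagram n) : Fintype (Curve f g) :=
  Fintype.ofFinite _

/-- Some lift of the curve `c` is mapped to itself by the deck transformation `γ`. -/
def Curve.Invariant {n : ℕ} {f g : Diagram n} (c : Curve f g) (γ : ℤ × ℤ → ℤ × ℤ) : Prop :=
  ∃ u, Quotient.mk (sameCurve f g) u = c ∧ SameLift f g u (γ u)

open Classical in
/-- The variable of a closed curve.  A simple closed curve on the Klein bottle is isotopic to the
core of the first Möbius band (`x`), to the core of the second one (`y`), to the two-sided
nonseparating curve, which runs once through both crosscaps (`w`; deck transformation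
`deck₁ ∘ deck₂⁻¹`), to the common boundary circle of the two Möbius bands (`z`; deck
transformation `deck₁ ∘ deck₁`), or it is contractible (`d`; its lifts are closed). -/
noncomputable def Curve.weight {R : Type*} {n : ℕ} {f g : Diagram n} (d w x y z : R)
    (c : Curve f g) : R :=
  if c.Invariant (deck₁ n) then x
  else if c.Invariant (deck₂ n) then y
  else if c.Invariant (fun u => (u.1, u.2 + 2)) then w
  else if c.Invariant (fun u => (u.1 + 2 * n, u.2)) then z
  else d

/-- The bilinear form on crossingless connections: the monomial of the closed curves on the Klein
bottle that arise from gluing `f` with the inversion of `g`. -/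
noncomputable def form {R : Type*} [CommRing R] {n : ℕ} [NeZero n] (d w x y z : R)
    (f g : Diagram n) : R :=
  ∏ c : Curve f g, c.weight d w x y z

/-- The Gram matrix of type `Mb`. -/
noncomputable def gramMatrix {R : Type*} [CommRing R] (n : ℕ) [NeZero n] (d w x y z : R) :
    Matrix (Diagram n) (Diagram n) R :=
  Matrix.of fun f g => form d w x y z f g

open Classical in
/-- The Gram determinant of type `Mb`.  Without marked points there is only the empty connection,
and the Gram matrix is `(1)`. -/
noncomputable def gramDet {R : Type*} [CommRing R] : ℕ → R → R → R → R → R → R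
  | 0, _, _, _, _, _ => 1
  | n + 1, d, w, x, y, z => (gramMatrix (n + 1) d w x y z).det

end MobiusGram

/-!
Capping off the marked points `t` and `t + 1` of a connection `g` is adjoint to inserting a short
arc at `t` into `f`: both amount to joining `t` and `t + 1`, so the curves of `⟨insertArc t f, g⟩`
deform to those of `⟨f, capOff t g⟩`, except for one closed curve that is cut off if `g` joins `t`
and `t + 1`. That curve depends only on `g`, so the two monomials differ by a factor that depends
only on `g`. Hence each family of rows of the Gram matrix indexed by the connections `insertArc t f`
is a left multiple by the Gram matrix `G` of the next smaller size. No connection has short arcs at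
`t` and at `t + 1`, so `t = 0` and `t = 1` give disjoint families of rows, the block matrix
`diag(G, G)` is a left factor of the rows in both families, and `(det G) ^ 2` divides the
determinant.
-/

namespace MobiusGram

section Linking

variable {n : ℕ} {a b c d p q r : ℤ × Bool}

theorem precedes_irrefl (p : ℤ × Bool) : ¬ Precedes p p := by
  obtain ⟨i, _ | _⟩ := p <;> simp [Precedes]

theorem Precedes.trans (hpq : Precedes p q) (hqr : Precedes q r) : Precedes p r := by
  obtain ⟨i, _ | _⟩ := p <;> obtain ⟨j, _ | _⟩ := q <;> obtain ⟨k, _ | _⟩ := r <;> grind [Precedes]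

theorem Precedes.asymm (hpq : Precedes p q) : ¬ Precedes q p :=
  fun hqp => precedes_irrefl p (hpq.trans hqp)

theorem precedes_or_precedes (h : p ≠ q) : Precedes p q ∨ Precedes q p := by
  obtain ⟨i, _ | _⟩ := p <;> obtain ⟨j, _ | _⟩ := q <;> grind [Precedes]

theorem not_precedes (h : p ≠ q) : ¬ Precedes p q ↔ Precedes q p :=
  ⟨(precedes_or_precedes h).resolve_left, Precedes.asymm⟩

/-- The point `q` does not lie between `a` and `b` on the boundary of the strip. -/
def Outside (a b q : ℤ × Bool) : Prop := Precedes q a ↔ Precedes q b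

/-- The chord of the strip from `a` to `b` does not separate `c` from `d`. -/
def Unlinked (a b c d : ℤ × Bool) : Prop := Outside a b c ↔ Outside a b d

theorem unlinked_comm (hac : a ≠ c) (had : a ≠ d) (hbc : b ≠ c) (hbd : b ≠ d) :
    Unlinked a b c d ↔ Unlinked c d a b := by
  grind [Unlinked, Outside, not_precedes]

theorem Unlinked.trans (h : Unlinked a b p q) (h' : Unlinked a b q r) : Unlinked a b p r :=
  Iff.trans h h'

theorem Unlinked.trans_left (h : Unlinked a b p q) (h' : Unlinked b c p q) :
    Unlinked a c p q := by
  grind [Unlinked, Outside]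

theorem Outside.unlinked (h : Outside a b p) (h' : Outside a b q) : Unlinked a b p q :=
  iff_of_true h h'

theorem Diagram.mate_injective (f : Diagram n) : Function.Injective f.mate :=
  Function.LeftInverse.injective f.mate_mate

theorem Diagram.mate_ne_of_ne (f : Diagram n) (h : q ≠ f.mate p) : f.mate q ≠ p :=
  fun e => h (by rw [← e, f.mate_mate])

theorem Diagram.unlinked (f : Diagram n) (hp : q ≠ p) (hp' : q ≠ f.mate p) :
    Unlinked p (f.mate p) q (f.mate q) := by
  grind [Unlinked, Outside, not_precedes, Precedes.trans, f.mate_mate, f.mate_ne, f.noncrossing]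

/-- The connection with a given matching; that the arcs can be made disjoint is stated without
reference to an order of the four endpoints. -/
def Diagram.ofUnlinked (mate : ℤ × Bool → ℤ × Bool) (mate_mate : ∀ p, mate (mate p) = p)
    (mate_ne : ∀ p, mate p ≠ p) (mate_shift : ∀ p, mate (shift n p) = shift n (mate p))
    (unlinked : ∀ p q, q ≠ p → q ≠ mate p → Unlinked p (mate p) q (mate q)) : Diagram n where
  mate := mate
  mate_mate := mate_mate
  mate_ne := mate_ne
  mate_shift := mate_shift
  noncrossing := by
    rintro p q ⟨h₁, h₂, h₃⟩
    have := unlinked p q (fun h => (h ▸ h₁).asymm (h ▸ h₁)) (fun h => (h ▸ h₂).asymm (h ▸ h₂))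
    grind [Unlinked, Outside, Precedes.asymm, Precedes.trans]

end Linking

section Label

variable {n : ℕ} {p q : ℤ × Bool}

/-- The marked point below a lifted marked point, as a residue modulo `2n`. -/
def label (n : ℕ) (p : ℤ × Bool) : ZMod (2 * n) := ((p.1 + p.2.toNat * n : ℤ) : ZMod (2 * n))

theorem label_shift (n : ℕ) (p : ℤ × Bool) : label n (shift n p) = label n p := by
  have h : ((2 * n : ℕ) : ZMod (2 * n)) = 0 := ZMod.natCast_self _
  push_cast at h
  obtain ⟨i, _ | _⟩ := p
  · simp only [label, shift, Bool.not_false, Bool.toNat_true, Bool.toNat_false]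
    push_cast
    linear_combination h
  · simp [label, shift]

theorem label_eq_iff : label n q = label n p ↔
    ∃ k : ℤ, q = (p.1 + 2 * n * k, p.2) ∨ q = shift n (p.1 + 2 * n * k, p.2) := by
  constructor
  · intro h
    obtain ⟨k, hk⟩ := ((ZMod.intCast_eq_intCast_iff_dvd_sub _ _ _).1 h.symm)
    push_cast at hk
    obtain ⟨i, _ | _⟩ := p <;> obtain ⟨j, _ | _⟩ := q <;>
      simp only [Bool.toNat_false, Bool.toNat_true] at hk <;> push_cast at hk
    · exact ⟨k, .inl (Prod.ext (by linarith) rfl)⟩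
    · exact ⟨k - 1, .inr (Prod.ext (by simp only [shift]; linarith) rfl)⟩
    · exact ⟨k, .inr (Prod.ext (by simp only [shift]; linarith) rfl)⟩
    · exact ⟨k, .inl (Prod.ext (by linarith) rfl)⟩
  · have key (k : ℤ) : label n (p.1 + 2 * n * k, p.2) = label n p := by
      have h : ((2 * n : ℕ) : ZMod (2 * n)) = 0 := ZMod.natCast_self _
      push_cast at h
      simp only [label]
      push_cast
      linear_combination (k : ZMod (2 * n)) * h
    rintro ⟨k, rfl | rfl⟩
    · exact key k
    · rw [label_shift, key]

theorem label_eq_intCast_iff {t : ℤ} :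
    label n p = t ↔ (2 * n : ℤ) ∣ p.1 - p.2.toNat * n - t := by
  rw [label, ZMod.intCast_eq_intCast_iff_dvd_sub]
  push_cast
  constructor <;> rintro ⟨k, hk⟩ <;> exact ⟨-k - p.2.toNat, by linear_combination -hk⟩

theorem label_add (n : ℕ) (p : ℤ × Bool) (k : ℤ) : label n (p.1 + k, p.2) = label n p + k := by
  simp only [label]
  push_cast
  ring

theorem Diagram.label_mate_congr (f : Diagram n) (h : label n q = label n p) :
    label n (f.mate q) = label n (f.mate p) := by
  obtain ⟨k, rfl | rfl⟩ := label_eq_iff.1 h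
  · exact label_eq_iff.2 ⟨k, .inl (f.mate_add ..)⟩
  · exact label_eq_iff.2 ⟨k, .inr (by rw [f.mate_shift, f.mate_add])⟩

theorem Diagram.label_mate_ne [NeZero n] (f : Diagram n) (p : ℤ × Bool) :
    label n (f.mate p) ≠ label n p := by
  intro h
  obtain ⟨k, hk | hk⟩ := label_eq_iff.1 h
  · have hfst : p.1 + 2 * n * k + 2 * n * k = p.1 := by
      simpa only [hk, f.mate_add] using congrArg Prod.fst (f.mate_mate p)
    exact f.mate_ne p (hk.trans (Prod.ext (by linarith) rfl))
  · have hfst : p.1 + 2 * n * k + n + 2 * n * k + n = p.1 := by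
      have := congrArg Prod.fst (f.mate_mate p)
      rwa [hk, f.mate_shift, f.mate_add, hk] at this
    have : (n : ℤ) * (2 * k + 1) = 0 := by linarith
    rcases mul_eq_zero.1 this with h0 | h0
    · exact NeZero.ne n (by exact_mod_cast h0)
    · omega

end Label

section Spread

variable {n : ℕ} {t : ℤ} {p q : ℤ × Bool}

theorem two_mul_pos (n : ℕ) [NeZero n] : (0 : ℤ) < 2 * n := by
  have := NeZero.pos n
  omega

/-- The strictly monotone map `ℤ → ℤ` that leaves out the integers congruent to `t` and `t + 1`
modulo `2n + 2`. -/
def spreadLine (n : ℕ) (t i : ℤ) : ℤ := i + 2 * (i / (2 * n)) + t + 2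

theorem spreadLine_add (n : ℕ) [NeZero n] (t i : ℤ) :
    spreadLine n t (i + 2 * n) = spreadLine n t i + 2 * (n + 1) := by
  rw [spreadLine, Int.add_ediv_of_dvd_right dvd_rfl, Int.ediv_self (two_mul_pos n).ne', spreadLine]
  ring

theorem spreadLine_strictMono (n : ℕ) [NeZero n] (t : ℤ) : StrictMono (spreadLine n t) := by
  intro i j h
  have := Int.ediv_le_ediv (two_mul_pos n) h.le
  unfold spreadLine
  linarith

theorem mem_range_spreadLine [NeZero n] {j : ℤ} :
    j ∈ Set.range (spreadLine n t) ↔ 2 ≤ (j - t) % (2 * (n + 1)) := by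
  have hn := two_mul_pos n
  constructor
  · rintro ⟨i, rfl⟩
    have h₀ := Int.emod_nonneg i hn.ne'
    have h₁ := Int.emod_lt_of_pos i hn
    have hi : spreadLine n t i - t = i % (2 * n) + 2 + 2 * (n + 1) * (i / (2 * n)) := by
      rw [spreadLine]
      linear_combination -Int.emod_add_mul_ediv i (2 * n)
    rw [hi, Int.add_mul_emod_self_left, Int.emod_eq_of_lt] <;> omega
  · intro hj
    have h₁ := Int.emod_lt_of_pos (j - t) (b := 2 * (n + 1)) (by omega)
    have hj' := Int.emod_add_mul_ediv (j - t) (2 * (n + 1))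
    set k := (j - t) / (2 * (n + 1))
    set s := (j - t) % (2 * (n + 1))
    have hk : (s - 2 + 2 * n * k) / (2 * n) = k := by
      rw [Int.add_mul_ediv_left _ _ hn.ne', Int.ediv_eq_zero_of_lt] <;> omega
    refine ⟨s - 2 + 2 * n * k, ?_⟩
    rw [spreadLine, hk]
    linear_combination hj'

/-- The embedding of the lifts of `2n` marked points into those of `2n + 2` marked points that
leaves out the marked points `t` and `t + 1`. -/
def spread (n : ℕ) (t : ℤ) (p : ℤ × Bool) : ℤ × Bool :=
  (spreadLine n t (p.1 - p.2.toNat * n) + p.2.toNat * (n + 1), p.2)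

theorem spread_shift [NeZero n] (p : ℤ × Bool) :
    spread n t (shift n p) = shift (n + 1) (spread n t p) := by
  obtain ⟨i, _ | _⟩ := p
  · simp [spread, shift]
  · have := spreadLine_add n t (i - n)
    rw [show i - n + 2 * n = (i + n : ℤ) by ring] at this
    ext
    · simp only [spread, shift, Bool.not_true, Bool.toNat_false, Bool.toNat_true, Nat.cast_zero,
        zero_mul, sub_zero, Nat.cast_one, one_mul, this]
      push_cast
      ring
    · simp [spread, shift]

theorem precedes_spread [NeZero n] : Precedes (spread n t p) (spread n t q) ↔ Precedes p q := by
  obtain ⟨i, _ | _⟩ := p <;> obtain ⟨j, _ | _⟩ := q <;>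
    simp [spread, Precedes, (spreadLine_strictMono n t).lt_iff_lt]

theorem spread_injective (n : ℕ) [NeZero n] (t : ℤ) : Function.Injective (spread n t) := by
  intro p q h
  by_contra hpq
  rcases precedes_or_precedes hpq with h' | h' <;>
    exact precedes_irrefl _ (h ▸ precedes_spread (t := t).2 h')

theorem unlinked_spread [NeZero n] {a b c d : ℤ × Bool} :
    Unlinked (spread n t a) (spread n t b) (spread n t c) (spread n t d) ↔ Unlinked a b c d := by
  simp only [Unlinked, Outside, precedes_spread]

theorem mem_range_spread [NeZero n] : p ∈ Set.range (spread n t) ↔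
    label (n + 1) p ≠ t ∧ label (n + 1) p ≠ (t + 1 : ℤ) := by
  have h : p ∈ Set.range (spread n t) ↔
      p.1 - p.2.toNat * (n + 1) ∈ Set.range (spreadLine n t) := by
    constructor
    · rintro ⟨q, rfl⟩
      exact ⟨_, (add_sub_cancel_right _ _).symm⟩
    · rintro ⟨i, hi⟩
      refine ⟨(i + p.2.toNat * n, p.2), Prod.ext ?_ rfl⟩
      simp [spread, hi]
  have hn := two_mul_pos n
  rw [h, mem_range_spreadLine, ne_eq, label_eq_intCast_iff, ne_eq, label_eq_intCast_iff]
  push_cast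
  set j := p.1 - p.2.toNat * (n + 1 : ℤ)
  have h₀ := Int.emod_nonneg (j - t) (b := 2 * (n + 1)) (by omega)
  have h₁ : 2 * (n + 1 : ℤ) ∣ j - (t + 1) ↔ (j - t) % (2 * (n + 1)) = 1 := by
    rw [← sub_sub, ← Int.modEq_iff_dvd, Int.ModEq, Int.emod_eq_of_lt zero_le_one (by omega),
      eq_comm]
  rw [Int.dvd_iff_emod_eq_zero, h₁]
  omega

theorem mem_range_spread_congr [NeZero n] (h : label (n + 1) q = label (n + 1) p) :
    q ∈ Set.range (spread n t) ↔ p ∈ Set.range (spread n t) := by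
  rw [mem_range_spread, mem_range_spread, h]

end Spread

section Partner

variable {n : ℕ} {t : ℤ} {p q : ℤ × Bool}

/-- The exchange of the lifts of the marked points `t` and `t + 1`. -/
def partner (n : ℕ) (t : ℤ) (p : ℤ × Bool) : ℤ × Bool :=
  (if label (n + 1) p = t then p.1 + 1 else p.1 - 1, p.2)

theorem partner_ne (p : ℤ × Bool) : partner n t p ≠ p := by
  intro h
  have := congrArg Prod.fst h
  grind [partner]

theorem partner_shift (p : ℤ × Bool) :
    partner n t (shift (n + 1) p) = shift (n + 1) (partner n t p) := by
  ext
  · rw [partner, label_shift]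
    simp only [partner, shift]
    split_ifs <;> ring
  · rfl

theorem label_partner_of_eq (h : label (n + 1) p = t) :
    label (n + 1) (partner n t p) = (t + 1 : ℤ) := by
  rw [partner, if_pos h, label_add, h, Int.cast_add]

theorem intCast_add_one_ne (n : ℕ) (t : ℤ) : ((t + 1 : ℤ) : ZMod (2 * (n + 1))) ≠ t := by
  have : Fact (1 < 2 * (n + 1)) := ⟨by omega⟩
  simp

theorem label_partner_of_eq_add_one (h : label (n + 1) p = (t + 1 : ℤ)) :
    label (n + 1) (partner n t p) = t := by
  rw [partner, if_neg (h.trans_ne (intCast_add_one_ne n t)), sub_eq_add_neg, label_add, h]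
  push_cast
  ring

theorem not_mem_range_spread [NeZero n] : p ∉ Set.range (spread n t) ↔
    label (n + 1) p = t ∨ label (n + 1) p = (t + 1 : ℤ) := by
  rw [mem_range_spread]
  tauto

theorem label_eq_or_of_not_mem_range_spread [NeZero n] (hp : p ∉ Set.range (spread n t))
    (hq : q ∉ Set.range (spread n t)) :
    label (n + 1) q = label (n + 1) p ∨ label (n + 1) q = label (n + 1) (partner n t p) := by
  rcases not_mem_range_spread.1 hp with h | h
  · rw [h, label_partner_of_eq h]
    exact not_mem_range_spread.1 hq
  · rw [h, label_partner_of_eq_add_one h]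
    exact (not_mem_range_spread.1 hq).symm

theorem partner_partner [NeZero n] (hp : p ∉ Set.range (spread n t)) :
    partner n t (partner n t p) = p := by
  rcases not_mem_range_spread.1 hp with h | h
  · rw [partner, if_neg ((label_partner_of_eq h).trans_ne (intCast_add_one_ne n t)), partner,
      if_pos h, add_sub_cancel_right]
  · rw [partner, if_pos (label_partner_of_eq_add_one h), partner,
      if_neg (h.trans_ne (intCast_add_one_ne n t)), sub_add_cancel]

theorem partner_not_mem_range_spread [NeZero n] (hp : p ∉ Set.range (spread n t)) :
    partner n t p ∉ Set.range (spread n t) :=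
  not_mem_range_spread.2 <| (not_mem_range_spread.1 hp).symm.imp label_partner_of_eq_add_one
    label_partner_of_eq

theorem outside_partner (hqp : q ≠ p) (hq : q ≠ partner n t p) : Outside p (partner n t p) q := by
  obtain ⟨i, _ | _⟩ := p <;> obtain ⟨j, _ | _⟩ := q <;> grind [Outside, Precedes, partner]

end Partner

section InsertArc

variable {n : ℕ} {t : ℤ} {p q : ℤ × Bool}

/-- The matching `f` of `2n` marked points, with the marked points `t` and `t + 1` inserted and
joined by a short arc. -/
noncomputable def insertArcMate (t : ℤ) (f : Diagram n) : ℤ × Bool → ℤ × Bool :=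
  Function.extend (spread n t) (spread n t ∘ f.mate) (partner n t)

theorem insertArcMate_of_not_mem (f : Diagram n) (hp : p ∉ Set.range (spread n t)) :
    insertArcMate t f p = partner n t p :=
  Function.extend_apply' _ _ _ hp

variable [NeZero n]

theorem insertArcMate_spread (f : Diagram n) (p : ℤ × Bool) :
    insertArcMate t f (spread n t p) = spread n t (f.mate p) :=
  (spread_injective n t).extend_apply ..

theorem insertArcMate_insertArcMate (f : Diagram n) (p : ℤ × Bool) :
    insertArcMate t f (insertArcMate t f p) = p := by
  by_cases hp : p ∈ Set.range (spread n t)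
  · obtain ⟨p, rfl⟩ := hp
    rw [insertArcMate_spread, insertArcMate_spread, f.mate_mate]
  · rw [insertArcMate_of_not_mem f hp,
      insertArcMate_of_not_mem f (partner_not_mem_range_spread hp), partner_partner hp]

theorem unlinked_insertArcMate (f : Diagram n) (hp : q ≠ p) (hp' : q ≠ insertArcMate t f p) :
    Unlinked p (insertArcMate t f p) q (insertArcMate t f q) := by
  have hq : insertArcMate t f q ≠ p := fun h =>
    hp' (by rw [← h, insertArcMate_insertArcMate])
  have hq' : insertArcMate t f q ≠ insertArcMate t f p := fun h =>
    hp (by rw [← insertArcMate_insertArcMate f q, h, insertArcMate_insertArcMate])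
  by_cases hps : p ∈ Set.range (spread n t)
  · by_cases hqs : q ∈ Set.range (spread n t)
    · obtain ⟨p, rfl⟩ := hps
      obtain ⟨q, rfl⟩ := hqs
      simp only [insertArcMate_spread, ne_eq, (spread_injective n t).eq_iff] at hp hp' ⊢
      exact unlinked_spread.2 (f.unlinked hp hp')
    · rw [unlinked_comm hp.symm hq.symm hp'.symm hq'.symm]
      rw [insertArcMate_of_not_mem f hqs] at hq hq' ⊢
      exact (outside_partner hp.symm hq.symm).unlinked (outside_partner hp'.symm hq'.symm)
  · rw [insertArcMate_of_not_mem f hps] at hp' hq' ⊢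
    exact (outside_partner hp hp').unlinked (outside_partner hq hq')

/-- The connection `f` with two more marked points `t` and `t + 1`, joined by a short arc. -/
noncomputable def insertArc (t : ℤ) (f : Diagram n) : Diagram (n + 1) :=
  Diagram.ofUnlinked (insertArcMate t f) (insertArcMate_insertArcMate f)
    (fun p => by
      by_cases hp : p ∈ Set.range (spread n t)
      · obtain ⟨p, rfl⟩ := hp
        rw [insertArcMate_spread]
        exact (spread_injective n t).ne (f.mate_ne p)
      · rw [insertArcMate_of_not_mem f hp]
        exact partner_ne p)
    (fun p => by
      by_cases hp : p ∈ Set.range (spread n t)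
      · obtain ⟨p, rfl⟩ := hp
        rw [← spread_shift, insertArcMate_spread, insertArcMate_spread, f.mate_shift, spread_shift]
      · rw [insertArcMate_of_not_mem f hp, ← partner_shift, insertArcMate_of_not_mem]
        rwa [mem_range_spread_congr (label_shift _ p)])
    (fun _ _ => unlinked_insertArcMate f)

theorem insertArc_mate_spread (f : Diagram n) (p : ℤ × Bool) :
    (insertArc t f).mate (spread n t p) = spread n t (f.mate p) :=
  insertArcMate_spread f p

theorem insertArc_mate_of_not_mem (f : Diagram n) (hp : p ∉ Set.range (spread n t)) :
    (insertArc t f).mate p = partner n t p :=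
  insertArcMate_of_not_mem f hp

theorem insertArc_injective (t : ℤ) : Function.Injective (insertArc (n := n) t) := by
  intro f f' h
  ext1
  funext p
  apply spread_injective n t
  rw [← insertArc_mate_spread, h, insertArc_mate_spread]

theorem insertArc_ne_insertArc_add_one (f f' : Diagram n) :
    insertArc t f ≠ insertArc (t + 1) f' := by
  intro h
  have ht : label (n + 1) (t + 1, false) = (t + 1 : ℤ) := by simp [label]
  have : ((insertArc t f).mate (t + 1, false)).1 =
      ((insertArc (t + 1) f').mate (t + 1, false)).1 := by
    rw [h]
  rw [insertArc_mate_of_not_mem f (not_mem_range_spread.2 (.inr ht)),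
    insertArc_mate_of_not_mem f' (not_mem_range_spread.2 (.inl ht)), partner, partner, if_pos ht,
    if_neg (ht.trans_ne (intCast_add_one_ne n t))] at this
  omega

end InsertArc

section CapOff

variable {n : ℕ} {t : ℤ} {g : Diagram (n + 1)} {p q r : ℤ × Bool}

open Classical in
/-- The endpoint of the arc that starts at `p` once the marked points `t` and `t + 1` are joined by
an outer arc to `g`. -/
noncomputable def detour (t : ℤ) (g : Diagram (n + 1)) (p : ℤ × Bool) : ℤ × Bool :=
  if g.mate p ∈ Set.range (spread n t) then g.mate p else g.mate (partner n t (g.mate p))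

theorem detour_of_mem (h : g.mate p ∈ Set.range (spread n t)) : detour t g p = g.mate p :=
  if_pos h

theorem detour_of_not_mem (h : g.mate p ∉ Set.range (spread n t)) :
    detour t g p = g.mate (partner n t (g.mate p)) :=
  if_neg h

theorem detour_ne (p : ℤ × Bool) : detour t g p ≠ p := by
  by_cases hw : g.mate p ∈ Set.range (spread n t)
  · rw [detour_of_mem hw]
    exact g.mate_ne p
  · rw [detour_of_not_mem hw]
    intro h
    exact partner_ne (n := n) (t := t) (g.mate p) (g.mate_injective (by rw [h, g.mate_mate]))

theorem unlinked_detour_mate (h₁ : r ≠ p) (h₂ : r ≠ g.mate p) (h₃ : r ≠ detour t g p)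
    (h₄ : g.mate p ∉ Set.range (spread n t) → r ≠ partner n t (g.mate p)) :
    Unlinked p (detour t g p) r (g.mate r) := by
  by_cases hw : g.mate p ∈ Set.range (spread n t)
  · rw [detour_of_mem hw]
    exact g.unlinked h₁ h₂
  · rw [detour_of_not_mem hw] at h₃ ⊢
    have hout : Unlinked (g.mate p) (partner n t (g.mate p)) r (g.mate r) :=
      (outside_partner h₂ (h₄ hw)).unlinked
        (outside_partner (g.mate_ne_of_ne (by rwa [g.mate_mate])) (g.mate_ne_of_ne h₃))
    exact ((g.unlinked h₁ h₂).trans_left hout).trans_left (g.unlinked (h₄ hw) h₃)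

variable [NeZero n]

theorem detour_mem_range_spread (hp : p ∈ Set.range (spread n t)) :
    detour t g p ∈ Set.range (spread n t) := by
  by_cases hw : g.mate p ∈ Set.range (spread n t)
  · rwa [detour_of_mem hw]
  · rw [detour_of_not_mem hw]
    by_contra hz
    rcases label_eq_or_of_not_mem_range_spread hw hz with h | h
    · have h' := g.label_mate_congr h
      rw [g.mate_mate, g.mate_mate] at h'
      exact partner_not_mem_range_spread hw ((mem_range_spread_congr h').2 hp)
    · exact g.label_mate_ne _ h

theorem detour_detour (hp : p ∈ Set.range (spread n t)) : detour t g (detour t g p) = p := by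
  by_cases hw : g.mate p ∈ Set.range (spread n t)
  · rw [detour_of_mem hw, detour_of_mem (by rwa [g.mate_mate]), g.mate_mate]
  · rw [detour_of_not_mem hw, detour_of_not_mem, g.mate_mate, partner_partner hw, g.mate_mate]
    rw [g.mate_mate]
    exact partner_not_mem_range_spread hw

theorem detour_shift (p : ℤ × Bool) :
    detour t g (shift (n + 1) p) = shift (n + 1) (detour t g p) := by
  by_cases hw : g.mate p ∈ Set.range (spread n t)
  · rw [detour_of_mem hw, detour_of_mem, g.mate_shift]
    rwa [g.mate_shift, mem_range_spread_congr (label_shift _ _)]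
  · rw [detour_of_not_mem hw, detour_of_not_mem, g.mate_shift, partner_shift, g.mate_shift]
    rwa [g.mate_shift, mem_range_spread_congr (label_shift _ _)]

theorem unlinked_detour (hp : p ∈ Set.range (spread n t)) (hq : q ∈ Set.range (spread n t))
    (hqp : q ≠ p) (hq' : q ≠ detour t g p) :
    Unlinked p (detour t g p) q (detour t g q) := by
  have hdp := detour_mem_range_spread (g := g) hp
  have hne {x y : ℤ × Bool} (hx : x ∉ Set.range (spread n t)) (hy : y ∈ Set.range (spread n t)) :
      x ≠ y := fun h => hx (h ▸ hy)
  have hq₁ : Unlinked p (detour t g p) q (g.mate q) := by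
    refine unlinked_detour_mate hqp ?_ hq' fun h => (hne (partner_not_mem_range_spread h) hq).symm
    by_cases hw : g.mate p ∈ Set.range (spread n t)
    · rwa [detour_of_mem hw] at hq'
    · exact (hne hw hq).symm
  by_cases hw : g.mate q ∈ Set.range (spread n t)
  · rwa [detour_of_mem hw]
  rw [detour_of_not_mem hw]
  have hw' := partner_not_mem_range_spread hw
  have hq₂ : Unlinked p (detour t g p) (g.mate q) (partner n t (g.mate q)) := by
    rw [unlinked_comm (hne hw hp).symm (hne hw' hp).symm (hne hw hdp).symm (hne hw' hdp).symm]
    exact (outside_partner (hne hw hp).symm (hne hw' hp).symm).unlinked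
      (outside_partner (hne hw hdp).symm (hne hw' hdp).symm)
  refine (hq₁.trans hq₂).trans (unlinked_detour_mate (hne hw' hp) ?_ (hne hw' hdp) fun h e => ?_)
  · intro e
    apply hq'
    rw [detour_of_not_mem (e ▸ hw'), ← e, partner_partner hw, g.mate_mate]
  · apply hqp
    rw [← g.mate_mate q, ← partner_partner hw, e, partner_partner h, g.mate_mate]

/-- The matching of `capOff t g`, which is `detour t g` in terms of the `2n` remaining marked
points. -/
noncomputable def capOffMate (t : ℤ) (g : Diagram (n + 1)) (p : ℤ × Bool) : ℤ × Bool :=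
  Function.invFun (spread n t) (detour t g (spread n t p))

theorem spread_capOffMate (t : ℤ) (g : Diagram (n + 1)) (p : ℤ × Bool) :
    spread n t (capOffMate t g p) = detour t g (spread n t p) :=
  Function.invFun_eq (detour_mem_range_spread ⟨p, rfl⟩)

/-- The connection obtained from `g` by joining the marked points `t` and `t + 1` by an outer arc
and deleting the closed curve that may arise. -/
noncomputable def capOff (t : ℤ) (g : Diagram (n + 1)) : Diagram n :=
  Diagram.ofUnlinked (capOffMate t g)
    (fun p => spread_injective n t (by
      rw [spread_capOffMate, spread_capOffMate, detour_detour ⟨p, rfl⟩]))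
    (fun p h => detour_ne (g := g) (spread n t p) (by rw [← spread_capOffMate, h]))
    (fun p => spread_injective n t (by
      rw [spread_capOffMate, spread_shift, spread_shift, spread_capOffMate, detour_shift]))
    (fun p q hqp hq => by
      rw [← unlinked_spread (n := n) (t := t), spread_capOffMate, spread_capOffMate]
      refine unlinked_detour ⟨p, rfl⟩ ⟨q, rfl⟩ ((spread_injective n t).ne hqp) ?_
      rw [← spread_capOffMate]
      exact (spread_injective n t).ne hq)

theorem spread_capOff_mate (t : ℤ) (g : Diagram (n + 1)) (p : ℤ × Bool) :
    spread n t ((capOff t g).mate p) = detour t g (spread n t p) :=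
  spread_capOffMate t g p

end CapOff

section LiftToPlane

variable {m n : ℕ} {s : ℤˣ} {φ ψ : ℤ × Bool → ℤ × Bool} {f g : Diagram n} {u v : ℤ × ℤ}

/-- The point of the boundary of the strip over which a lifted marked point of the plane lies, when
every strip of the plane is reflected onto the strip of height one. -/
def onStrip (u : ℤ × ℤ) : ℤ × Bool := (u.1, decide (u.2 % 2 = 1))

/-- The action of a map of the boundary of the strip on all strips of the plane that cover the first
Möbius band (`s = 1`) or the second one (`s = -1`). -/
def liftToPlane (s : ℤˣ) (φ : ℤ × Bool → ℤ × Bool) (u : ℤ × ℤ) : ℤ × ℤ :=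
  ((φ (onStrip u)).1, u.2 - s * (onStrip u).2.toNat + s * (φ (onStrip u)).2.toNat)

theorem onStrip_add (i m : ℤ) (b : Bool) (s : ℤˣ) : onStrip (i, 2 * m + s * b.toNat) = (i, b) := by
  rcases Int.units_eq_one_or s with rfl | rfl <;> cases b <;> simp [onStrip]

theorem exists_eq_onStrip_add (s : ℤˣ) (u : ℤ × ℤ) :
    ∃ m : ℤ, u = (u.1, 2 * m + s * (onStrip u).2.toNat) := by
  have heven : 2 ∣ u.2 - s * (onStrip u).2.toNat := by
    rcases Int.units_eq_one_or s with rfl | rfl <;>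
      rcases Int.emod_two_eq_zero_or_one u.2 with h | h <;> simp [onStrip, h] <;> omega
  obtain ⟨m, hm⟩ := heven
  exact ⟨m, Prod.ext rfl (by linarith)⟩

theorem liftToPlane_add (s : ℤˣ) (φ : ℤ × Bool → ℤ × Bool) (i m : ℤ) (b : Bool) :
    liftToPlane s φ (i, 2 * m + s * b.toNat) =
      ((φ (i, b)).1, 2 * m + s * (φ (i, b)).2.toNat) := by
  simp [liftToPlane, onStrip_add]

theorem onStrip_liftToPlane (s : ℤˣ) (φ : ℤ × Bool → ℤ × Bool) (u : ℤ × ℤ) :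
    onStrip (liftToPlane s φ u) = φ (onStrip u) := by
  obtain ⟨m, hm⟩ := exists_eq_onStrip_add s u
  rw [hm, liftToPlane_add, onStrip_add, onStrip_add]

theorem liftToPlane_liftToPlane (s : ℤˣ) (φ ψ : ℤ × Bool → ℤ × Bool) (u : ℤ × ℤ) :
    liftToPlane s φ (liftToPlane s ψ u) = liftToPlane s (φ ∘ ψ) u := by
  rw [liftToPlane, onStrip_liftToPlane]
  simp [liftToPlane]

theorem liftToPlane_congr (h : φ (onStrip u) = ψ (onStrip u)) :
    liftToPlane s φ u = liftToPlane s ψ u := by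
  rw [liftToPlane, h, liftToPlane]

theorem liftToPlane_eq_self (h : φ (onStrip u) = onStrip u) : liftToPlane s φ u = u := by
  rw [liftToPlane, h, sub_add_cancel]
  rfl

theorem liftToPlane_eq_of_snd_eq (h : (φ (onStrip u)).2 = (onStrip u).2) :
    liftToPlane s φ u = ((φ (onStrip u)).1, u.2) := by
  rw [liftToPlane, h, sub_add_cancel]

theorem joined_iff :
    Joined f g u v ↔ v = liftToPlane 1 f.mate u ∨ v = liftToPlane (-1) g.mate u := by
  constructor
  · rintro (⟨m, i, j, b, c, h⟩ | ⟨m, i, j, b, c, h⟩)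
    · left
      simpa [h] using (liftToPlane_add 1 f.mate i m b).symm
    · right
      simpa [h, sub_eq_add_neg] using (liftToPlane_add (-1) g.mate i m b).symm
  · rintro (rfl | rfl)
    · obtain ⟨m, hm⟩ := exists_eq_onStrip_add 1 u
      rw [hm, liftToPlane_add]
      simpa using Joined.first (g := g) m _ _ _ _ (rfl : f.mate (u.1, (onStrip u).2) = _)
    · obtain ⟨m, hm⟩ := exists_eq_onStrip_add (-1) u
      rw [hm, liftToPlane_add]
      simpa [sub_eq_add_neg] using
        Joined.second (f := f) m _ _ _ _ (rfl : g.mate (u.1, (onStrip u).2) = _)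

/-- The deck transformations `deck₁` (`s = 1`) and `deck₂` (`s = -1`). -/
def deck (n : ℕ) (s : ℤˣ) (u : ℤ × ℤ) : ℤ × ℤ := (u.1 + n, s - u.2)

theorem deck_surjective (n : ℕ) (s : ℤˣ) : Function.Surjective (deck n s) :=
  fun u => ⟨(u.1 - n, s - u.2), by simp [deck]⟩

theorem deck_one (n : ℕ) (u : ℤ × ℤ) :
    deck n 1 u = ((deck n (-1) u).1, (deck n (-1) u).2 + 2) :=
  Prod.ext rfl (by simp only [deck]; push_cast; ring)

theorem deck_deck (n : ℕ) (s : ℤˣ) (u : ℤ × ℤ) : deck n s (deck n s u) = (u.1 + 2 * n, u.2) :=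
  Prod.ext (by simp only [deck]; ring) (sub_sub_cancel _ _)

theorem onStrip_deck (n : ℕ) (s : ℤˣ) (u : ℤ × ℤ) : onStrip (deck n s u) = shift n (onStrip u) := by
  ext
  · rfl
  · have : (s - u.2) % 2 = 1 ↔ ¬ u.2 % 2 = 1 := by
      rcases Int.units_eq_one_or s with rfl | rfl <;> push_cast <;> omega
    simp only [onStrip, deck, shift, this, decide_not]

theorem liftToPlane_deck (hφ : ∀ p, φ (shift n p) = shift m (φ p)) (s s' : ℤˣ) (u : ℤ × ℤ) :
    liftToPlane s φ (deck n s' u) = deck m s' (liftToPlane s φ u) := by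
  rw [liftToPlane, onStrip_deck, hφ, liftToPlane]
  ext
  · rfl
  · simp only [shift, deck]
    cases (onStrip u).2 <;> cases (φ (onStrip u)).2 <;>
      simp only [Bool.not_true, Bool.not_false, Bool.toNat_true, Bool.toNat_false] <;> push_cast <;>
      ring

theorem joined_self_first (f g : Diagram n) (u : ℤ × ℤ) : Joined f g u (liftToPlane 1 f.mate u) :=
  joined_iff.2 (.inl rfl)

theorem joined_self_second (f g : Diagram n) (u : ℤ × ℤ) :
    Joined f g u (liftToPlane (-1) g.mate u) :=
  joined_iff.2 (.inr rfl)

theorem Diagram.liftToPlane_mate_mate (f : Diagram n) (s : ℤˣ) (u : ℤ × ℤ) :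
    liftToPlane s f.mate (liftToPlane s f.mate u) = u := by
  rw [liftToPlane_liftToPlane]
  exact liftToPlane_eq_self (f.mate_mate _)

end LiftToPlane

section SpreadLift

variable {n : ℕ} {t : ℤ} {u : ℤ × ℤ}

/-- The map that `spread n t` induces on the lifted marked points in the plane. -/
def spreadLift (n : ℕ) (t : ℤ) : ℤ × ℤ → ℤ × ℤ := liftToPlane 1 (spread n t)

/-- The map that `partner n t` induces on the lifted marked points in the plane. -/
def partnerLift (n : ℕ) (t : ℤ) : ℤ × ℤ → ℤ × ℤ := liftToPlane 1 (partner n t)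

theorem spreadLift_eq (s : ℤˣ) (u : ℤ × ℤ) : spreadLift n t u = liftToPlane s (spread n t) u :=
  (liftToPlane_eq_of_snd_eq rfl).trans (liftToPlane_eq_of_snd_eq rfl).symm

theorem partnerLift_eq (s : ℤˣ) (u : ℤ × ℤ) : partnerLift n t u = liftToPlane s (partner n t) u :=
  (liftToPlane_eq_of_snd_eq rfl).trans (liftToPlane_eq_of_snd_eq rfl).symm

theorem onStrip_spreadLift (u : ℤ × ℤ) : onStrip (spreadLift n t u) = spread n t (onStrip u) :=
  onStrip_liftToPlane ..

theorem onStrip_partnerLift (u : ℤ × ℤ) : onStrip (partnerLift n t u) = partner n t (onStrip u) :=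
  onStrip_liftToPlane ..

theorem mem_range_spreadLift :
    u ∈ Set.range (spreadLift n t) ↔ onStrip u ∈ Set.range (spread n t) := by
  constructor
  · rintro ⟨a, rfl⟩
    exact ⟨_, (onStrip_spreadLift a).symm⟩
  · rintro ⟨p, hp⟩
    have h : onStrip (p.1, u.2) = p := Prod.ext rfl (congrArg Prod.snd hp).symm
    refine ⟨(p.1, u.2), ?_⟩
    rw [spreadLift, liftToPlane_eq_of_snd_eq rfl, h, hp]
    rfl

theorem spreadLift_injective (n : ℕ) [NeZero n] (t : ℤ) : Function.Injective (spreadLift n t) := by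
  intro u v h
  have hs : onStrip u = onStrip v := spread_injective n t (by
    rw [← onStrip_spreadLift, h, onStrip_spreadLift])
  have h₂ := congrArg Prod.snd h
  simp only [spreadLift] at h₂
  rw [liftToPlane_eq_of_snd_eq rfl, liftToPlane_eq_of_snd_eq rfl] at h₂
  exact Prod.ext (congrArg Prod.fst hs :) h₂

end SpreadLift

section Retract

variable {n : ℕ} [NeZero n] {t : ℤ} {f : Diagram n} {g : Diagram (n + 1)} {a u v : ℤ × ℤ}

theorem liftToPlane_insertArc_spreadLift (f : Diagram n) (a : ℤ × ℤ) :
    liftToPlane 1 (insertArc t f).mate (spreadLift n t a) =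
      spreadLift n t (liftToPlane 1 f.mate a) := by
  rw [spreadLift, liftToPlane_liftToPlane, liftToPlane_liftToPlane]
  exact liftToPlane_congr (insertArc_mate_spread f _)

theorem liftToPlane_insertArc_of_not_mem (f : Diagram n) (hu : u ∉ Set.range (spreadLift n t)) :
    liftToPlane 1 (insertArc t f).mate u = partnerLift n t u :=
  liftToPlane_congr (insertArc_mate_of_not_mem f (mem_range_spreadLift.not.1 hu))

theorem spreadLift_liftToPlane_capOff_of_mem
    (h : liftToPlane (-1) g.mate (spreadLift n t a) ∈ Set.range (spreadLift n t)) :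
    spreadLift n t (liftToPlane (-1) (capOff t g).mate a) =
      liftToPlane (-1) g.mate (spreadLift n t a) := by
  rw [mem_range_spreadLift, onStrip_liftToPlane, onStrip_spreadLift] at h
  rw [spreadLift_eq (-1), spreadLift_eq (-1), liftToPlane_liftToPlane, liftToPlane_liftToPlane]
  exact liftToPlane_congr ((spread_capOff_mate ..).trans (detour_of_mem h))

theorem spreadLift_liftToPlane_capOff_of_not_mem
    (h : liftToPlane (-1) g.mate (spreadLift n t a) ∉ Set.range (spreadLift n t)) :
    spreadLift n t (liftToPlane (-1) (capOff t g).mate a) =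
      liftToPlane (-1) g.mate (partnerLift n t (liftToPlane (-1) g.mate (spreadLift n t a))) := by
  rw [mem_range_spreadLift, onStrip_liftToPlane, onStrip_spreadLift] at h
  simp only [spreadLift_eq (-1), partnerLift_eq (-1), liftToPlane_liftToPlane]
  exact liftToPlane_congr ((spread_capOff_mate ..).trans (detour_of_not_mem h))

theorem partnerLift_not_mem (hu : u ∉ Set.range (spreadLift n t)) :
    partnerLift n t u ∉ Set.range (spreadLift n t) := by
  rw [mem_range_spreadLift] at hu ⊢
  rw [onStrip_partnerLift]
  exact partner_not_mem_range_spread hu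

theorem partnerLift_partnerLift (hu : u ∉ Set.range (spreadLift n t)) :
    partnerLift n t (partnerLift n t u) = u := by
  rw [partnerLift, liftToPlane_liftToPlane]
  exact liftToPlane_eq_self (partner_partner (mem_range_spreadLift.not.1 hu))

/-- The lifted marked point of `capOff t g` that corresponds to `u`: its preimage under
`spreadLift` or, if `u` lies over `t` or `t + 1`, that of the other endpoint of the lifted arc of
`g` at `u`; it is `none` if both endpoints of that arc lie over `t` or `t + 1`. -/
noncomputable def retractPoint (t : ℤ) (g : Diagram (n + 1)) (u : ℤ × ℤ) : Option (ℤ × ℤ) :=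
  (Function.partialInv (spreadLift n t) u).or
    (Function.partialInv (spreadLift n t) (liftToPlane (-1) g.mate u))

theorem partialInv_spreadLift (a : ℤ × ℤ) :
    Function.partialInv (spreadLift n t) (spreadLift n t a) = some a :=
  Function.partialInv_left (spreadLift_injective n t) a

theorem partialInv_of_not_mem {α β : Type*} {e : α → β} {y : β} (hy : y ∉ Set.range e) :
    Function.partialInv e y = none :=
  dif_neg hy

theorem retractPoint_spreadLift (a : ℤ × ℤ) : retractPoint t g (spreadLift n t a) = some a := by
  rw [retractPoint, partialInv_spreadLift, Option.some_or]

theorem retractPoint_of_not_mem (hu : u ∉ Set.range (spreadLift n t))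
    (h : liftToPlane (-1) g.mate u = spreadLift n t a) : retractPoint t g u = some a := by
  rw [retractPoint, partialInv_of_not_mem hu, h, partialInv_spreadLift, Option.none_or]

theorem retractPoint_eq_none_iff : retractPoint t g u = none ↔ u ∉ Set.range (spreadLift n t) ∧
    liftToPlane (-1) g.mate u ∉ Set.range (spreadLift n t) := by
  constructor
  · intro h
    rw [retractPoint, Option.or_eq_none_iff] at h
    constructor <;> rintro ⟨a, ha⟩ <;> simp [← ha, partialInv_spreadLift] at h
  · rintro ⟨hu, hgu⟩
    rw [retractPoint, partialInv_of_not_mem hu, partialInv_of_not_mem hgu, Option.none_or]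

theorem sameLift_of_retractPoint_eq_some (f : Diagram n) (h : retractPoint t g u = some a) :
    SameLift (insertArc t f) g u (spreadLift n t a) := by
  by_cases hu : u ∈ Set.range (spreadLift n t)
  · obtain ⟨b, rfl⟩ := hu
    rw [retractPoint_spreadLift, Option.some.injEq] at h
    exact h ▸ .refl _
  by_cases hgu : liftToPlane (-1) g.mate u ∈ Set.range (spreadLift n t)
  · obtain ⟨b, hb⟩ := hgu
    rw [retractPoint_of_not_mem hu hb.symm, Option.some.injEq] at h
    rw [← h, hb]
    exact .rel _ _ (joined_self_second ..)
  · simp [retractPoint_eq_none_iff.2 ⟨hu, hgu⟩] at h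

theorem retractPoint_partnerLift (hu : u ∉ Set.range (spreadLift n t)) :
    retractPoint t g (partnerLift n t u) =
      (retractPoint t g u).map (liftToPlane (-1) (capOff t g).mate) := by
  have key {v : ℤ × ℤ} {a : ℤ × ℤ} (hv : v ∉ Set.range (spreadLift n t))
      (ha : liftToPlane (-1) g.mate v = spreadLift n t a) :
      liftToPlane (-1) g.mate (partnerLift n t v) =
        spreadLift n t (liftToPlane (-1) (capOff t g).mate a) := by
    have hga : liftToPlane (-1) g.mate (spreadLift n t a) = v := by
      rw [← ha, g.liftToPlane_mate_mate]
    rw [spreadLift_liftToPlane_capOff_of_not_mem (hga ▸ hv), hga]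
  have hu' := partnerLift_not_mem hu
  by_cases h : liftToPlane (-1) g.mate u ∈ Set.range (spreadLift n t)
  · obtain ⟨a, ha⟩ := h
    rw [retractPoint_of_not_mem hu ha.symm, retractPoint_of_not_mem hu' (key hu ha.symm),
      Option.map_some]
  · rw [retractPoint_eq_none_iff.2 ⟨hu, h⟩, Option.map_none, retractPoint_eq_none_iff]
    refine ⟨hu', ?_⟩
    rintro ⟨b, hb⟩
    apply h
    rw [← partnerLift_partnerLift hu, key hu' hb.symm]
    exact ⟨_, rfl⟩

theorem map_retractPoint_first {κ : Type*} {F : ℤ × ℤ → κ}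
    (hF : ∀ a b, Joined f (capOff t g) a b → F a = F b) (u : ℤ × ℤ) :
    (retractPoint t g (liftToPlane 1 (insertArc t f).mate u)).map F =
      (retractPoint t g u).map F := by
  by_cases hu : u ∈ Set.range (spreadLift n t)
  · obtain ⟨a, rfl⟩ := hu
    rw [liftToPlane_insertArc_spreadLift, retractPoint_spreadLift, retractPoint_spreadLift,
      Option.map_some, Option.map_some]
    exact congrArg some (hF _ _ (joined_self_first ..)).symm
  · rw [liftToPlane_insertArc_of_not_mem f hu, retractPoint_partnerLift hu, Option.map_map]
    congr 1
    funext a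
    exact (hF _ _ (joined_self_second ..)).symm

theorem map_retractPoint_second {κ : Type*} {F : ℤ × ℤ → κ}
    (hF : ∀ a b, Joined f (capOff t g) a b → F a = F b) (u : ℤ × ℤ) :
    (retractPoint t g (liftToPlane (-1) g.mate u)).map F = (retractPoint t g u).map F := by
  have gg := g.liftToPlane_mate_mate (-1)
  by_cases hu : u ∈ Set.range (spreadLift n t) <;>
    by_cases hgu : liftToPlane (-1) g.mate u ∈ Set.range (spreadLift n t)
  · obtain ⟨a, rfl⟩ := hu
    rw [← spreadLift_liftToPlane_capOff_of_mem hgu, retractPoint_spreadLift,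
      retractPoint_spreadLift, Option.map_some, Option.map_some]
    exact congrArg some (hF _ _ (joined_self_second ..)).symm
  · obtain ⟨a, rfl⟩ := hu
    rw [retractPoint_spreadLift, retractPoint_of_not_mem hgu (gg _)]
  · obtain ⟨a, ha⟩ := hgu
    rw [← ha, retractPoint_spreadLift, retractPoint_of_not_mem hu ha.symm]
  · rw [retractPoint_eq_none_iff.2 ⟨hu, hgu⟩, retractPoint_eq_none_iff.2 ⟨hgu, by rwa [gg]⟩]

theorem map_retractPoint_of_joined {κ : Type*} {F : ℤ × ℤ → κ}
    (hF : ∀ a b, Joined f (capOff t g) a b → F a = F b) (h : Joined (insertArc t f) g u v) :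
    (retractPoint t g u).map F = (retractPoint t g v).map F := by
  rcases joined_iff.1 h with rfl | rfl
  · exact (map_retractPoint_first hF u).symm
  · exact (map_retractPoint_second hF u).symm

theorem spreadLift_deck (s : ℤˣ) (a : ℤ × ℤ) :
    spreadLift n t (deck n s a) = deck (n + 1) s (spreadLift n t a) :=
  liftToPlane_deck spread_shift 1 s a

theorem deck_mem_range_spreadLift (s : ℤˣ) :
    deck (n + 1) s u ∈ Set.range (spreadLift n t) ↔ u ∈ Set.range (spreadLift n t) := by
  rw [mem_range_spreadLift, mem_range_spreadLift, onStrip_deck,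
    mem_range_spread_congr (label_shift _ _)]

theorem retractPoint_semiconj_deck (s : ℤˣ) :
    Function.Semiconj (retractPoint t g) (deck (n + 1) s) (Option.map (deck n s)) := by
  intro u
  have hg := liftToPlane_deck g.mate_shift (-1) s u
  by_cases hu : u ∈ Set.range (spreadLift n t)
  · obtain ⟨a, rfl⟩ := hu
    rw [← spreadLift_deck, retractPoint_spreadLift, retractPoint_spreadLift, Option.map_some]
  have hdu := (deck_mem_range_spreadLift (t := t) s).not.2 hu
  by_cases hgu : liftToPlane (-1) g.mate u ∈ Set.range (spreadLift n t)
  · obtain ⟨a, ha⟩ := hgu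
    rw [retractPoint_of_not_mem hu ha.symm, Option.map_some,
      retractPoint_of_not_mem hdu (by rw [hg, ← ha, spreadLift_deck])]
  · rw [retractPoint_eq_none_iff.2 ⟨hu, hgu⟩, Option.map_none, retractPoint_eq_none_iff, hg]
    exact ⟨hdu, (deck_mem_range_spreadLift s).not.2 hgu⟩

end Retract

section CurveAt

variable {m n : ℕ} {f g : Diagram n} {f' g' : Diagram m} {u v : ℤ × ℤ} {κ : Type*} {F : ℤ × ℤ → κ}

/-- The closed curve on the Klein bottle through the marked point below `u`. -/
def curveAt (f g : Diagram n) (u : ℤ × ℤ) : Curve f g := Quotient.mk (sameCurve f g) u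

theorem curveAt_surjective (f g : Diagram n) : Function.Surjective (curveAt f g) :=
  Quotient.mk_surjective

theorem SameLift.map_eq (h : SameLift f g u v) (hF : ∀ u v, Joined f g u v → F u = F v) :
    F u = F v :=
  Setoid.eqvGen_le (s := Setoid.ker F) hF h

theorem map_eq_of_curveAt_eq (h : curveAt f g u = curveAt f g v)
    (hF : ∀ u v, Joined f g u v → F u = F v) (hd : ∀ s u, F (deck n s u) = F u) : F u = F v := by
  refine Setoid.eqvGen_le (s := Setoid.ker F) ?_ (Quotient.exact h)
  rintro u v (h | rfl | rfl)
  · exact hF u v h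
  · exact (hd 1 u).symm
  · exact (hd (-1) u).symm

theorem SameLift.curveAt_eq (h : SameLift f g u v) : curveAt f g u = curveAt f g v :=
  h.map_eq fun _ _ h => Quotient.sound (.rel _ _ (.inl h))

theorem curveAt_deck (f g : Diagram n) (s : ℤˣ) (u : ℤ × ℤ) :
    curveAt f g (deck n s u) = curveAt f g u := by
  symm
  apply Quotient.sound
  rcases Int.units_eq_one_or s with rfl | rfl
  · exact .rel _ _ (.inr (.inl rfl))
  · exact .rel _ _ (.inr (.inr rfl))

theorem curveAt_periodic_fst (f g : Diagram n) (h : ℤ) :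
    Function.Periodic (fun i => curveAt f g (i, h)) (2 * n) := by
  intro i
  beta_reduce
  rw [← deck_deck n 1 (i, h), curveAt_deck, curveAt_deck]

theorem curveAt_periodic_snd (f g : Diagram n) (i : ℤ) :
    Function.Periodic (fun h => curveAt f g (i, h)) 2 := by
  intro h
  obtain ⟨u, hu⟩ := deck_surjective n (-1) (i, h)
  have hup : (i, h + 2) = deck n 1 u := by rw [deck_one, hu]
  beta_reduce
  rw [hup, ← hu, curveAt_deck, curveAt_deck]

theorem curveAt_eq_of_onStrip_eq (h : onStrip u = onStrip v) : curveAt f g u = curveAt f g v := by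
  obtain ⟨i, a⟩ := u
  obtain ⟨j, b⟩ := v
  obtain ⟨rfl, hab⟩ : i = j ∧ (a % 2 = 1 ↔ b % 2 = 1) := by simpa [onStrip] using h
  have hb : b + (a - b) / 2 * 2 = a := by omega
  simpa only [Int.cast_id, hb] using (curveAt_periodic_snd f g i).int_mul ((a - b) / 2) b

theorem curveAt_eq_of_label_eq (h : label n (onStrip u) = label n (onStrip v)) :
    curveAt f g u = curveAt f g v := by
  obtain ⟨k, hk⟩ := label_eq_iff.1 h
  have hv : curveAt f g (v.1 + 2 * n * k, v.2) = curveAt f g v := by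
    simpa only [Int.cast_id, mul_comm k] using (curveAt_periodic_fst f g v.2).int_mul k v.1
  rw [← hv]
  rcases hk with hk | hk
  · exact curveAt_eq_of_onStrip_eq hk
  · rw [← curveAt_deck f g 1 (v.1 + 2 * n * k, v.2)]
    exact curveAt_eq_of_onStrip_eq (hk.trans (onStrip_deck n 1 (v.1 + 2 * n * k, v.2)).symm)

theorem Curve.weight_congr {R : Type*} (d w x y z : R) {c : Curve f g} {c' : Curve f' g'}
    (h₁ : c.Invariant (deck₁ n) ↔ c'.Invariant (deck₁ m))
    (h₂ : c.Invariant (deck₂ n) ↔ c'.Invariant (deck₂ m))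
    (h₃ : c.Invariant (fun u => (u.1, u.2 + 2)) ↔ c'.Invariant (fun u => (u.1, u.2 + 2)))
    (h₄ : c.Invariant (fun u => (u.1 + 2 * n, u.2)) ↔
      c'.Invariant (fun u => (u.1 + 2 * m, u.2))) :
    c.weight d w x y z = c'.weight d w x y z := by
  classical
  exact if_congr h₁ rfl <| if_congr h₂ rfl <| if_congr h₃ rfl <| if_congr h₄ rfl rfl

end CurveAt

section CurveRetract

variable {n : ℕ} [NeZero n] {t : ℤ} {f f' : Diagram n} {g : Diagram (n + 1)} {a b u v : ℤ × ℤ}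
  {γ δ : ℤ × ℤ → ℤ × ℤ}

theorem retractPoint_semiconj_up : Function.Semiconj (retractPoint (n := n) t g)
    (fun u => (u.1, u.2 + 2)) (Option.map fun u => (u.1, u.2 + 2)) := by
  intro u
  obtain ⟨u, rfl⟩ := deck_surjective (n + 1) (-1) u
  beta_reduce
  rw [← deck_one, retractPoint_semiconj_deck, retractPoint_semiconj_deck, Option.map_map]
  congr 1
  funext v
  exact deck_one n v

theorem retractPoint_semiconj_right : Function.Semiconj (retractPoint (n := n) t g)
    (fun u => (u.1 + 2 * (n + 1 : ℕ), u.2)) (Option.map fun u => (u.1 + 2 * n, u.2)) := by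
  simp only [← deck_deck _ 1]
  have h := (retractPoint_semiconj_deck (t := t) (g := g) 1).comp_right
    (retractPoint_semiconj_deck 1)
  rwa [Option.map_comp_map] at h

theorem sameLift_spreadLift (h : SameLift f (capOff t g) a b) :
    SameLift (insertArc t f) g (spreadLift n t a) (spreadLift n t b) := by
  refine Setoid.eqvGen_le
    (s := (Relation.EqvGen.setoid (Joined (insertArc t f) g)).comap (spreadLift n t)) ?_ h
  intro a b hab
  rw [Setoid.comap_rel]
  rcases joined_iff.1 hab with rfl | rfl
  · rw [← liftToPlane_insertArc_spreadLift]
    exact .rel _ _ (joined_self_first ..)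
  refine .trans _ _ _ (.rel _ _ (joined_self_second _ g (spreadLift n t a))) ?_
  by_cases h : liftToPlane (-1) g.mate (spreadLift n t a) ∈ Set.range (spreadLift n t)
  · rw [spreadLift_liftToPlane_capOff_of_mem h]
    exact .refl _
  · rw [spreadLift_liftToPlane_capOff_of_not_mem h, ← liftToPlane_insertArc_of_not_mem f h]
    exact .trans _ _ _ (.rel _ _ (joined_self_first ..)) (.rel _ _ (joined_self_second ..))

theorem curveAt_spreadLift_eq (h : curveAt f (capOff t g) a = curveAt f (capOff t g) b) :
    curveAt (insertArc t f) g (spreadLift n t a) =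
      curveAt (insertArc t f) g (spreadLift n t b) := by
  refine map_eq_of_curveAt_eq (F := fun a => curveAt (insertArc t f) g (spreadLift n t a)) h
    (fun a b hab => (sameLift_spreadLift (.rel _ _ hab)).curveAt_eq) fun s a => ?_
  rw [spreadLift_deck, curveAt_deck]

theorem sameLift_of_retractPoint (h : SameLift (insertArc t f) g u v)
    (hu : retractPoint t g u = some a) (hv : retractPoint t g v = some b) :
    SameLift f (capOff t g) a b := by
  have key := h.map_eq fun u v => map_retractPoint_of_joined (F := Quot.mk (Joined f (capOff t g)))
    fun a b => Quot.sound
  rw [hu, hv, Option.map_some, Option.map_some, Option.some.injEq] at key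
  exact Quot.eqvGen_exact key

/-- The curve to which a curve through `g` with an arc inserted is deformed when `g` is capped off,
or `none` for the curve that is cut off if `g` joins `t` and `t + 1`. -/
noncomputable def Curve.retract (t : ℤ) (f : Diagram n) (g : Diagram (n + 1)) :
    Curve (insertArc t f) g → Option (Curve f (capOff t g)) :=
  Quotient.lift (fun u => (retractPoint t g u).map (curveAt f (capOff t g))) fun _ _ h =>
    map_eq_of_curveAt_eq (Quotient.sound h)
      (fun _ _ => map_retractPoint_of_joined fun _ _ h => SameLift.curveAt_eq (.rel _ _ h))
      fun s u => by
        rw [retractPoint_semiconj_deck, Option.map_map]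
        congr 1
        funext a
        exact curveAt_deck ..

theorem Curve.retract_curveAt (u : ℤ × ℤ) : Curve.retract t f g (curveAt _ _ u) =
    (retractPoint t g u).map (curveAt f (capOff t g)) :=
  rfl

theorem curveAt_eq_of_not_mem (hu : u ∉ Set.range (spreadLift n t))
    (hv : v ∉ Set.range (spreadLift n t)) :
    curveAt (insertArc t f) g u = curveAt (insertArc t f) g v := by
  rcases label_eq_or_of_not_mem_range_spread (mem_range_spreadLift.not.1 hv)
    (mem_range_spreadLift.not.1 hu) with h | h
  · exact curveAt_eq_of_label_eq h
  · rw [← onStrip_partnerLift, ← liftToPlane_insertArc_of_not_mem f hv] at h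
    exact (curveAt_eq_of_label_eq h).trans
      (SameLift.curveAt_eq (.rel _ _ (joined_self_first ..))).symm

theorem Curve.retract_injective : Function.Injective (Curve.retract t f g) := by
  intro c c' h
  obtain ⟨u, rfl⟩ := curveAt_surjective _ _ c
  obtain ⟨v, rfl⟩ := curveAt_surjective _ _ c'
  rw [retract_curveAt, retract_curveAt] at h
  rcases hu : retractPoint t g u with _ | a <;>
    rcases hv : retractPoint t g v with _ | b <;> simp only [hu, hv, Option.map_some,
      Option.map_none, Option.some.injEq, reduceCtorEq] at h
  · exact curveAt_eq_of_not_mem (retractPoint_eq_none_iff.1 hu).1 (retractPoint_eq_none_iff.1 hv).1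
  · exact ((sameLift_of_retractPoint_eq_some f hu).curveAt_eq.trans (curveAt_spreadLift_eq h)).trans
      (sameLift_of_retractPoint_eq_some f hv).curveAt_eq.symm

theorem Curve.some_mem_range_retract (c : Curve f (capOff t g)) :
    some c ∈ Set.range (Curve.retract t f g) := by
  obtain ⟨a, rfl⟩ := curveAt_surjective _ _ c
  refine ⟨curveAt _ _ (spreadLift n t a), ?_⟩
  rw [retract_curveAt, retractPoint_spreadLift, Option.map_some]

theorem invariant_curveAt_iff_of_retractPoint
    (hγ : Function.Semiconj (retractPoint t g) δ (Option.map γ))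
    (hu : retractPoint t g u = some a) :
    (curveAt (insertArc t f) g u).Invariant δ ↔ (curveAt f (capOff t g) a).Invariant γ := by
  constructor
  · rintro ⟨v, hv, h⟩
    obtain ⟨b, hb, hba⟩ :
        ∃ b, retractPoint t g v = some b ∧ curveAt f (capOff t g) b = curveAt _ _ a := by
      rw [← Option.map_eq_some_iff, ← Curve.retract_curveAt]
      exact (congrArg _ hv).trans (by rw [Curve.retract_curveAt, hu, Option.map_some])
    exact ⟨b, hba, sameLift_of_retractPoint h hb (by rw [hγ, hb, Option.map_some])⟩
  · rintro ⟨b, hb, h⟩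
    refine ⟨spreadLift n t b, (curveAt_spreadLift_eq hb).trans
      (sameLift_of_retractPoint_eq_some f hu).curveAt_eq.symm, ?_⟩
    refine .trans _ _ _ (sameLift_spreadLift h) (.symm _ _ (sameLift_of_retractPoint_eq_some f ?_))
    rw [hγ, retractPoint_spreadLift, Option.map_some]

theorem weight_curveAt_of_retractPoint {R : Type*} (d w x y z : R)
    (hu : retractPoint t g u = some a) :
    (curveAt (insertArc t f) g u).weight d w x y z =
      (curveAt f (capOff t g) a).weight d w x y z :=
  Curve.weight_congr d w x y z
    (invariant_curveAt_iff_of_retractPoint (retractPoint_semiconj_deck 1) hu)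
    (invariant_curveAt_iff_of_retractPoint (retractPoint_semiconj_deck (-1)) hu)
    (invariant_curveAt_iff_of_retractPoint retractPoint_semiconj_up hu)
    (invariant_curveAt_iff_of_retractPoint retractPoint_semiconj_right hu)

theorem joined_insertArc_of_retractPoint_eq_none (hu : retractPoint (n := n) t g u = none)
    (h : Joined (insertArc t f) g u v) : Joined (insertArc t f') g u v := by
  rw [joined_iff, liftToPlane_insertArc_of_not_mem _ (retractPoint_eq_none_iff.1 hu).1] at h ⊢
  exact h

theorem retractPoint_eq_none_congr
    (h : curveAt (insertArc t f) g u = curveAt (insertArc t f) g v) :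
    retractPoint (n := n) t g u = none ↔ retractPoint (n := n) t g v = none := by
  rw [← Option.map_eq_none_iff, ← Curve.retract_curveAt, h, Curve.retract_curveAt,
    Option.map_eq_none_iff]

open Classical in
theorem SameLift.insertArc_of_retractPoint_eq_none (h : SameLift (insertArc t f) g u v)
    (hu : retractPoint (n := n) t g u = none) : SameLift (insertArc t f') g u v := by
  let F (u : ℤ × ℤ) : Option (Quot (Joined (insertArc t f') g)) :=
    if retractPoint (n := n) t g u = none then some (Quot.mk _ u) else none
  have hv := (retractPoint_eq_none_congr h.curveAt_eq).1 hu
  have key : F u = F v := by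
    refine h.map_eq fun u v huv => ?_
    have huv' := retractPoint_eq_none_congr (SameLift.curveAt_eq (.rel _ _ huv))
    by_cases hu : retractPoint (n := n) t g u = none
    · simp only [F, if_pos hu, if_pos (huv'.1 hu)]
      exact congrArg some (Quot.sound (joined_insertArc_of_retractPoint_eq_none hu huv))
    · simp only [F, if_neg hu, if_neg (huv'.not.1 hu)]
  simp only [F, if_pos hu, if_pos hv, Option.some.injEq] at key
  exact Quot.eqvGen_exact key

theorem weight_curveAt_of_retractPoint_eq_none {R : Type*} (d w x y z : R) (f f' : Diagram n)
    (hu : retractPoint (n := n) t g u = none) :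
    (curveAt (insertArc t f) g u).weight d w x y z =
      (curveAt (insertArc t f') g u).weight d w x y z := by
  have key (f f' : Diagram n) (γ : ℤ × ℤ → ℤ × ℤ)
      (h : (curveAt (insertArc t f) g u).Invariant γ) :
      (curveAt (insertArc t f') g u).Invariant γ := by
    obtain ⟨v, hv, h⟩ := h
    have hv' : retractPoint (n := n) t g v = none := (retractPoint_eq_none_congr hv).2 hu
    exact ⟨v, curveAt_eq_of_not_mem (retractPoint_eq_none_iff.1 hv').1
      (retractPoint_eq_none_iff.1 hu).1, h.insertArc_of_retractPoint_eq_none hv'⟩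
  have key' (γ) := Iff.intro (key f f' γ) (key f' f γ)
  exact Curve.weight_congr d w x y z (key' _) (key' _) (key' _) (key' _)

end CurveRetract

section Adjunction

variable {R : Type*} {n : ℕ} [NeZero n]

open Classical in
/-- The variable of the closed curve that capping off cuts off if `g` joins `t` and `t + 1`, and `1`
otherwise. The curve consists of arcs of `g` and the inserted arc, so any connection could replace
`capOff t g` in the definition. -/
noncomputable def capOffFactor [One R] (d w x y z : R) (t : ℤ) (g : Diagram (n + 1)) : R :=
  if retractPoint (n := n) t g (t, 0) = none then
    (curveAt (insertArc t (capOff t g)) g (t, 0)).weight d w x y z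
  else 1

theorem not_mem_range_spreadLift (n : ℕ) [NeZero n] (t : ℤ) :
    (t, 0) ∉ Set.range (spreadLift n t) := by
  rw [mem_range_spreadLift, not_mem_range_spread]
  left
  simp [onStrip, label]

theorem weight_eq_elim_retract [One R] (d w x y z : R) {t : ℤ} {f : Diagram n}
    {g : Diagram (n + 1)} (c : Curve (insertArc t f) g) : c.weight d w x y z =
      (c.retract t f g).elim (capOffFactor d w x y z t g) (Curve.weight d w x y z) := by
  obtain ⟨u, rfl⟩ := curveAt_surjective _ _ c
  rw [Curve.retract_curveAt]
  rcases hu : retractPoint t g u with _ | a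
  · have hut : curveAt (insertArc t f) g u = curveAt (insertArc t f) g (t, 0) :=
      curveAt_eq_of_not_mem (retractPoint_eq_none_iff.1 hu).1 (not_mem_range_spreadLift n t)
    have ht := (retractPoint_eq_none_congr hut).1 hu
    rw [Option.map_none, Option.elim_none, capOffFactor, if_pos ht, hut]
    exact weight_curveAt_of_retractPoint_eq_none d w x y z _ _ ht
  · exact weight_curveAt_of_retractPoint d w x y z hu

theorem form_insertArc [CommRing R] (d w x y z : R) (t : ℤ) (f : Diagram n) (g : Diagram (n + 1)) :
    form d w x y z (insertArc t f) g =
      capOffFactor d w x y z t g * form d w x y z f (capOff t g) := by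
  have hrange (o : Option (Curve f (capOff t g))) (ho : o ∉ Set.range (Curve.retract t f g)) :
      o.elim (capOffFactor d w x y z t g) (Curve.weight d w x y z) = 1 := by
    rcases o with _ | c
    · refine if_neg fun h => ho ⟨curveAt _ _ (t, 0), ?_⟩
      rw [Curve.retract_curveAt, h, Option.map_none]
    · exact absurd (Curve.some_mem_range_retract c) ho
  rw [form, Fintype.prod_of_injective (Curve.retract t f g) Curve.retract_injective _ _ hrange
    (weight_eq_elim_retract d w x y z), Fintype.prod_option]
  rfl

end Adjunction

section GramDeterminant

variable {R M K : Type*} [CommRing R] [Fintype M] [DecidableEq M] [Fintype K] [DecidableEq K]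

theorem det_dvd_det_of_submatrix_eq_mul (A : Matrix M M R) (B : Matrix K K R) (Q : Matrix K M R)
    {ι : K → M} (hι : Function.Injective ι) (h : A.submatrix ι id = B * Q) : B.det ∣ A.det := by
  classical
  let e : K ⊕ ((Set.range ι)ᶜ : Set M) ≃ M :=
    ((Equiv.ofInjective ι hι).sumCongr (Equiv.refl _)).trans (Equiv.Set.sumCompl (Set.range ι))
  have hA : A.submatrix e e = Matrix.fromBlocks B 0 0 1 *
      Matrix.fromRows (Q.submatrix id e) (A.submatrix (e ∘ Sum.inr) e) := by
    rw [Matrix.fromBlocks_mul_fromRows, Matrix.zero_mul, Matrix.zero_mul, add_zero, zero_add,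
      Matrix.one_mul]
    ext (k | k) j
    · exact congrFun (congrFun h k) (e j)
    · rfl
  rw [← Matrix.det_submatrix_equiv_self e A, hA, Matrix.det_mul, Matrix.det_fromBlocks_zero₂₁,
    Matrix.det_one, mul_one]
  exact dvd_mul_right _ _

theorem insertArc_zero_one_injective (n : ℕ) [NeZero n] : Function.Injective
    (Sum.elim (insertArc 0) (insertArc 1) : Diagram n ⊕ Diagram n → Diagram (n + 1)) :=
  (insertArc_injective 0).sumElim (insertArc_injective 1) insertArc_ne_insertArc_add_one

open Classical in
/-- The matrix of the linear map on formal combinations of connections that sends `g` to the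
multiple of `capOff t g` by `capOffFactor`; it is the adjoint of the insertion of an arc. -/
noncomputable def capOffMatrix (n : ℕ) [NeZero n] (d w x y z : R) (t : ℤ) :
    Matrix (Diagram n) (Diagram (n + 1)) R :=
  Matrix.of fun f g => if f = capOff t g then capOffFactor d w x y z t g else 0

theorem gramMatrix_submatrix_insertArc (n : ℕ) [NeZero n] (d w x y z : R) (t : ℤ) :
    (gramMatrix (n + 1) d w x y z).submatrix (insertArc t) id =
      gramMatrix n d w x y z * capOffMatrix n d w x y z t := by
  classical
  ext f g
  simp [Matrix.mul_apply, gramMatrix, capOffMatrix, form_insertArc, mul_comm]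

open Classical in
theorem det_gramMatrix_sq_dvd (n : ℕ) [NeZero n] (d w x y z : R) :
    (gramMatrix n d w x y z).det ^ 2 ∣ (gramMatrix (n + 1) d w x y z).det := by
  let G := gramMatrix n d w x y z
  have hrows : (gramMatrix (n + 1) d w x y z).submatrix
      (Sum.elim (insertArc 0) (insertArc 1)) id = Matrix.fromBlocks G 0 0 G *
        Matrix.fromRows (capOffMatrix n d w x y z 0) (capOffMatrix n d w x y z 1) := by
    rw [Matrix.fromBlocks_mul_fromRows, Matrix.zero_mul, Matrix.zero_mul, add_zero, zero_add,
      ← gramMatrix_submatrix_insertArc, ← gramMatrix_submatrix_insertArc]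
    ext (f | f) g <;> rfl
  have hdvd := det_dvd_det_of_submatrix_eq_mul _ _ _ (insertArc_zero_one_injective n) hrows
  rwa [Matrix.det_fromBlocks_zero₂₁, ← sq] at hdvd

end GramDeterminant

end MobiusGram

theorem mainTheorem7_general {R : Type*} [CommRing R] (d w x y z : R) (n : ℕ) :
    MobiusGram.gramDet n d w x y z ^ 2 ∣ MobiusGram.gramDet (n + 1) d w x y z := by
  cases n with
  | zero => simp [MobiusGram.gramDet]
  | succ n => exact MobiusGram.det_gramMatrix_sq_dvd (n + 1) d w x y z

theorem mainTheorem7 {R : Type*} [CommRing R] (d w x y z : R) (hd : IsUnit (d ^ 2 - 1))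
    (n : ℕ) (hn : 1 ≤ n) :
    (MobiusGram.gramDet (n - 1) d w x y z) ^ 2 ∣ MobiusGram.gramDet n d w x y z := by
  obtain ⟨n, rfl⟩ := Nat.exists_eq_add_of_le' hn
  exact mainTheorem7_general d w x y z n
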